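/- Let $M$ be a nonempty saturated structure in a first-order language $L$: for every $A'\subseteq M$ with $|A'|<|M|$, every complete type in finitely many variables over $A'$ is realized in $M$. Let $A\subseteq M$ with $|A|<|M|$, let $p\in S_n(A)$ be a non-algebraic complete type (no formula in $p$ has only finitely many solutions), let $p(M)\subseteq M^n$ be its set of realizations, and let $(p,<)$ be a weakly o-minimal pair over $A$; that is, $<$ is a strict linear order on $p(M)$ which is the trace on $p(M)^2$ of some $L_A$-formula, and for every $L_M$-formula $\phi(x)$ the set $\phi(M)\cap p(M)$ is a finite union of $<$-convex subsets of $p(M)$. Let $\mathbf p_r$ (respectively $\mathbf p_l$) be the global type in $S_n(M)$ consisting of all $L_M$-formulas $\phi(x)$ such that $\phi(M)\cap p(M)$ contains a nonempty final (respectively initial) part of $(p(M),<)$; these are complete types. For a global type $\mathfrak p$ and a linear order $I$, a sequence $(a_i)_{i\in I}$ of $n$-tuples is *Morley in $\mathfrak p$ over $A$* if $a_i\models\mathfrak p_{\restriction A a_{<i}}$ for all $i\in I$. The type $\mathfrak p$ is *$A$-invariant* if $(\phi(x,b_1)\leftrightarrow\phi(x,b_2))\in\mathfrak p$ for every $L_A$-formula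 $\phi(x,y)$ and all finite tuples $b_1,b_2$ with the same type over $A$. It is *trivial over $A$* (respectively *order-trivial over $A$*) if it is non-algebraic, $A$-invariant, and every sequence $(a_i)_{i\in\omega}$ such that $(a_i,a_j)$ is Morley in $\mathfrak p$ over $A$ for all $i<j$ (respectively such that $(a_i,a_{i+1})$ is Morley in $\mathfrak p$ over $A$ for all $i$) is itself Morley in $\mathfrak p$ over $A$. For $n$-tuples $a,b$ write $a\triangleleft b$ if $b\models(\mathbf p_r)_{\restriction Aa}$. A sequence $(a_i)_{i\in I}$ is *$\triangleleft$-increasing* (respectively *$\triangleleft$-decreasing*) if $a_i\triangleleft a_j$ (respectively $a_j\triangleleft a_i$) for all $i<j$ in $I$. Then the following are equivalent: 1. $\mathbf p_r$ is trivial over $A$; 2. every $\triangleleft$-increasing sequence $(a_i)_{i\in\omega}$ of realizations of $p$ is Morley in $\mathbf p_r$ over $A$; 3. for every linear order $I$, every $\triangleleft$-increasing sequence $(a_i)_{i\in I}$ of realizations of $p$ is Morley in $\mathbf p_r$ over $A$; 4. $\mathbf p_r$ is order-trivial over $A$; 5. every $\triangleleft$-decreasing sequence $(a_i)_{i\in\omega}$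 of realizations of $p$ is Morley in $\mathbf p_l$ over $A$; 6. for every linear order $I$, every $\triangleleft$-decreasing sequence $(a_i)_{i\in I}$ of realizations of $p$ is Morley in $\mathbf p_l$ over $A$; 7. $\mathbf p_l$ is order-trivial over $A$. -/

import Mathlib

open FirstOrder FirstOrder.Language Cardinal

universe u v w t

namespace WeakOMin

section Types

variable (L : FirstOrder.Language.{u, v}) (M : Type w) [L.Structure M]

/-- `S_n(A)`: complete `n`-types over the parameter set `A`, in the complete theory of `M`. -/
abbrev TypeOver (A : Set M) (n : ℕ) := (L[[A]].completeTheory M).CompleteType (Fin n)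

/-- `S_n(M)`: global complete `n`-types. -/
abbrev GlobalType (n : ℕ) := (L[[M]].completeTheory M).CompleteType (Fin n)

end Types

section Basic

variable {L : FirstOrder.Language.{u, v}} {M : Type w} [L.Structure M] {n : ℕ}

/-- `p(M)`: the set of realizations in `M` of a type over `A`. -/
def locus {A : Set M} (p : TypeOver L M A n) : Set (Fin n → M) :=
  {a | ∀ φ : L[[A]].Formula (Fin n), Formula.equivSentence φ ∈ p → φ.Realize a}

variable (L M) in
/-- `M` is saturated: every complete type in finitely many variables over a set of parameters of
cardinality less than `|M|` is realized in `M`. -/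
def IsSaturated : Prop :=
  ∀ A : Set M, #A < #M → ∀ (m : ℕ) (p : TypeOver L M A m), (locus p).Nonempty

/-- A type over `A` is non-algebraic: it contains no formula with only finitely many solutions. -/
def IsNonalgebraic {A : Set M} (p : TypeOver L M A n) : Prop :=
  ∀ φ : L[[A]].Formula (Fin n), Formula.equivSentence φ ∈ p → {a : Fin n → M | φ.Realize a}.Infinite

/-- The same notion for global types. -/
def IsNonalgebraicGlobal (P : GlobalType L M n) : Prop :=
  ∀ φ : L[[M]].Formula (Fin n), Formula.equivSentence φ ∈ P → {a : Fin n → M | φ.Realize a}.Infinite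

/-- An `L_B`-formula regarded as an `L_M`-formula. -/
def liftFormula {B : Set M} {α : Type*} (φ : L[[B]].Formula α) : L[[M]].Formula α :=
  (L.lhomWithConstantsMap (Subtype.val : B → M)).onFormula φ

/-- `φ(x, b)`: the parameters `b` are substituted for the variables `y` of `φ(x, y)`. -/
def substParams {m : ℕ} (φ : L[[M]].Formula (Fin n ⊕ Fin m)) (b : Fin m → M) :
    L[[M]].Formula (Fin n) :=
  BoundedFormula.subst φ (Sum.elim (fun i => Term.var i) (fun j => (L.con (b j)).term))

/-- `a ≡ b (A)`. -/
def SameTypeOver (A : Set M) {m : ℕ} (a b : Fin m → M) : Prop :=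
  ∀ φ : L[[A]].Formula (Fin m), φ.Realize a ↔ φ.Realize b

/-- The global type `P` is `A`-invariant. -/
def IsInvariant (P : GlobalType L M n) (A : Set M) : Prop :=
  ∀ (m : ℕ) (φ : L[[A]].Formula (Fin n ⊕ Fin m)) (b₁ b₂ : Fin m → M),
    SameTypeOver (L := L) A b₁ b₂ →
      Formula.equivSentence
        ((substParams (liftFormula φ) b₁).iff (substParams (liftFormula φ) b₂)) ∈ P

/-- `a` realizes the restriction of the global type `P` to the parameter set `B`. -/
def RealizesRestriction (P : GlobalType L M n) (B : Set M) (a : Fin n → M) : Prop :=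
  ∀ φ : L[[B]].Formula (Fin n), Formula.equivSentence (liftFormula φ) ∈ P → φ.Realize a

/-- The sequence `(a i)`, indexed by a linear order, is a Morley sequence in `P` over `A`:
each `a i` realizes the restriction of `P` to `A` together with the coordinates of all `a j`,
`j < i`. -/
def IsMorley (P : GlobalType L M n) (A : Set M) {I : Type*} [LinearOrder I]
    (a : I → Fin n → M) : Prop :=
  ∀ i, RealizesRestriction P (A ∪ ⋃ j, ⋃ _ : j < i, Set.range (a j)) (a i)

/-- The global type `P` is trivial over `A`. -/
def IsTrivialOver (P : GlobalType L M n) (A : Set M) : Prop :=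
  IsNonalgebraicGlobal P ∧ IsInvariant P A ∧
    ∀ a : ℕ → Fin n → M, (∀ i j, i < j → IsMorley P A ![a i, a j]) → IsMorley P A a

/-- The global type `P` is order-trivial over `A`. -/
def IsOrderTrivialOver (P : GlobalType L M n) (A : Set M) : Prop :=
  IsNonalgebraicGlobal P ∧ IsInvariant P A ∧
    ∀ a : ℕ → Fin n → M, (∀ i, IsMorley P A ![a i, a (i + 1)]) → IsMorley P A a

end Basic

section Order

variable {X : Type*}

/-- `C` is convex with respect to the strict order `lt`. -/
def IsConvex (lt : X → X → Prop) (C : Set X) : Prop :=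
  ∀ a ∈ C, ∀ b ∈ C, ∀ c, lt a c → lt c b → c ∈ C

/-- `D` contains a (nonempty) final part of `X`. -/
def RightEventual (lt : X → X → Prop) (D : Set X) : Prop :=
  ∃ F : Set X, F.Nonempty ∧ (∀ a ∈ F, ∀ b, lt a b → b ∈ F) ∧ F ⊆ D

/-- `D` contains a (nonempty) initial part of `X`. -/
def LeftEventual (lt : X → X → Prop) (D : Set X) : Prop :=
  ∃ F : Set X, F.Nonempty ∧ (∀ a ∈ F, ∀ b, lt b a → b ∈ F) ∧ F ⊆ D

theorem rightEventual_iff {lt : X → X → Prop} (h : IsStrictTotalOrder X lt) (D : Set X) :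
    RightEventual lt D ↔ ∃ a, ∀ x, (a = x ∨ lt a x) → x ∈ D := by
  constructor
  · rintro ⟨F, ⟨a, ha⟩, hF, hD⟩
    refine ⟨a, ?_⟩
    rintro x (rfl | hx)
    · exact hD ha
    · exact hD (hF a ha x hx)
  · rintro ⟨a, ha⟩
    refine ⟨{x | a = x ∨ lt a x}, ⟨a, Or.inl rfl⟩, ?_, ha⟩
    rintro b (rfl | hb) c hc
    · exact Or.inr hc
    · exact Or.inr (_root_.trans hb hc)

/-- The filter of right-eventual sets. -/
def rightFilter {lt : X → X → Prop} (h : IsStrictTotalOrder X lt) (hX : Nonempty X) :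
    Filter X where
  sets := {D | RightEventual lt D}
  univ_sets := (rightEventual_iff h _).2 ⟨hX.some, fun _ _ => trivial⟩
  sets_of_superset := by
    rintro D E ⟨F, h1, h2, h3⟩ hDE
    exact ⟨F, h1, h2, h3.trans hDE⟩
  inter_sets := by
    intro D E hD hE
    obtain ⟨a, ha⟩ := (rightEventual_iff h D).1 hD
    obtain ⟨b, hb⟩ := (rightEventual_iff h E).1 hE
    refine (rightEventual_iff h _).2 ?_
    rcases trichotomous_of lt a b with hab | rfl | hab
    · refine ⟨b, fun x hx => ⟨ha x (Or.inr ?_), hb x hx⟩⟩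
      rcases hx with rfl | hx
      · exact hab
      · exact _root_.trans hab hx
    · exact ⟨a, fun x hx => ⟨ha x hx, hb x hx⟩⟩
    · refine ⟨a, fun x hx => ⟨ha x hx, hb x (Or.inr ?_)⟩⟩
      rcases hx with rfl | hx
      · exact hab
      · exact _root_.trans hab hx

theorem rightFilter_neBot {lt : X → X → Prop} (h : IsStrictTotalOrder X lt) (hX : Nonempty X) :
    (rightFilter h hX).NeBot := by
  refine ⟨fun hb => ?_⟩
  have h0 : (∅ : Set X) ∈ rightFilter h hX := by rw [hb]; trivial
  obtain ⟨F, ⟨a, ha⟩, -, hF⟩ := (show RightEventual lt ∅ from h0)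
  exact hF ha

theorem dichotomy {lt : X → X → Prop} (h : IsStrictTotalOrder X lt) (hX : Nonempty X)
    {S : Set (Set X)} (hS : S.Finite) (hC : ∀ C ∈ S, IsConvex lt C) :
    ⋃₀ S ∈ rightFilter h hX ∨ (⋃₀ S)ᶜ ∈ rightFilter h hX := by
  by_cases hcof : ∃ C ∈ S, C ∈ rightFilter h hX
  · obtain ⟨C, hCS, hCr⟩ := hcof
    exact Or.inl (Filter.mem_of_superset hCr (Set.subset_sUnion_of_mem hCS))
  · right
    rw [Set.compl_sUnion, Set.sInter_image]
    refine (Filter.biInter_mem hS).2 fun C hCS => ?_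
    by_contra hn
    refine hcof ⟨C, hCS, ?_⟩
    have hb : ∀ a, ∃ c ∈ C, a = c ∨ lt a c := by
      intro a
      by_contra hc
      push Not at hc
      refine hn ((rightEventual_iff h _).2 ⟨a, fun x hx hxC => ?_⟩)
      rcases hx with rfl | hx
      · exact (hc a hxC).1 rfl
      · exact (hc x hxC).2 hx
    obtain ⟨c, hc, -⟩ := hb hX.some
    refine (rightEventual_iff h _).2 ⟨c, ?_⟩
    rintro x (rfl | hx)
    · exact hc
    · obtain ⟨d, hd, rfl | hxd⟩ := hb x
      · exact hd
      · exact hC C hCS c hc d hd x hx hxd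

end Order

section WeaklyOMinimal

variable {L : FirstOrder.Language.{u, v}} {M : Type w} [L.Structure M] {n : ℕ} {A : Set M}

/-- `(p, lt)` is a weakly o-minimal pair over `A`: `lt` is a relatively `A`-definable strict linear
order on `p(M)`, and every subset of `p(M)` that is relatively definable with parameters from `M`
is a union of finitely many `lt`-convex sets. -/
structure IsWeaklyOMinimalPair (p : TypeOver L M A n) (lt : locus p → locus p → Prop) : Prop where
  strictTotalOrder : IsStrictTotalOrder (locus p) lt
  relDefinable : ∃ φ : L[[A]].Formula (Fin n ⊕ Fin n),
    ∀ a b : locus p, lt a b ↔ φ.Realize (Sum.elim a.1 b.1)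
  finiteConvex : ∀ ψ : L[[M]].Formula (Fin n), ∃ S : Set (Set (locus p)),
    S.Finite ∧ (∀ C ∈ S, IsConvex lt C) ∧ {a : locus p | ψ.Realize a.1} = ⋃₀ S

theorem IsWeaklyOMinimalPair.reverse {p : TypeOver L M A n} {lt : locus p → locus p → Prop}
    (h : IsWeaklyOMinimalPair p lt) : IsWeaklyOMinimalPair p (Function.swap lt) where
  strictTotalOrder := by
    have := h.strictTotalOrder
    infer_instance
  relDefinable := by
    obtain ⟨φ, hφ⟩ := h.relDefinable
    refine ⟨φ.relabel Sum.swap, fun a b => ?_⟩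
    rw [Formula.realize_relabel]
    refine (hφ b a).trans (iff_of_eq (congrArg _ ?_))
    funext i
    rcases i with i | i <;> rfl
  finiteConvex := by
    intro ψ
    obtain ⟨S, hS, hC, hD⟩ := h.finiteConvex ψ
    exact ⟨S, hS, fun C hCS a ha b hb c hac hcb => hC C hCS b hb a ha c hcb hac, hD⟩

/-- The set of sentences (formulas over `M` in `n` variables) that hold eventually along a filter on
a family of tuples is a complete global type, as soon as every formula is eventually decided. -/
theorem filter_isMaximal [Nonempty M] {X : Type*} (f : X → Fin n → M) (F : Filter X) (hF : F.NeBot)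
    (hd : ∀ ψ : L[[M]].Formula (Fin n),
      {x | ψ.Realize (f x)} ∈ F ∨ {x | ψ.Realize (f x)}ᶜ ∈ F)
    {T : L[[M]][[Fin n]].Theory}
    (hT : ∀ σ, σ ∈ T ↔ {x | (Formula.equivSentence.symm σ).Realize (f x)} ∈ F) :
    (L[[M]].lhomWithConstants (Fin n)).onTheory (L[[M]].completeTheory M) ⊆ T ∧
      T.IsMaximal := by
  have key : ∀ (σ : L[[M]][[Fin n]].Sentence) (x : X),
      (Formula.equivSentence.symm σ).Realize (f x) ↔
        @FirstOrder.Language.Sentence.Realize _ M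
          (@FirstOrder.Language.withConstantsStructure L[[M]] M _ (Fin n) (constantsOn.structure (f x))) σ :=
    fun σ x => Formula.realize_equivSentence_symm M σ (f x)
  refine ⟨?_, ?_, ?_⟩
  · rintro σ ⟨τ, hτ, rfl⟩
    rw [hT]
    refine Filter.univ_mem' fun x => ?_
    refine (key _ x).2 ?_
    let := constantsOn.structure (f x)
    exact (LHom.realize_onSentence M (L[[M]].lhomWithConstants (Fin n)) τ).2 hτ
  · rw [Theory.isSatisfiable_iff_isFinitelySatisfiable]
    intro T₀ hT₀
    have hmem : (⋂ σ ∈ T₀, {x | (Formula.equivSentence.symm σ).Realize (f x)}) ∈ F :=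
      (Filter.biInter_finset_mem T₀).2 fun σ hσ => (hT σ).1 (hT₀ hσ)
    obtain ⟨x, hx⟩ := hF.nonempty_of_mem hmem
    let := constantsOn.structure (f x)
    have : M ⊨ (T₀ : L[[M]][[Fin n]].Theory) :=
      ⟨fun σ hσ => (key σ x).1 (Set.mem_iInter₂.1 hx σ hσ)⟩
    exact Theory.Model.isSatisfiable M
  · intro σ
    rw [hT, hT]
    refine (hd (Formula.equivSentence.symm σ)).imp_right fun h => ?_
    convert h using 1
    ext x
    let := constantsOn.structure (f x)
    exact (key (Formula.not σ) x).trans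
      ((Sentence.realize_not M).trans (not_congr (key σ x)).symm)

theorem IsWeaklyOMinimalPair.decides {p : TypeOver L M A n} {lt : locus p → locus p → Prop}
    (h : IsWeaklyOMinimalPair p lt) (hne : (locus p).Nonempty) (ψ : L[[M]].Formula (Fin n)) :
    {x : locus p | ψ.Realize x.1} ∈ rightFilter h.strictTotalOrder hne.to_subtype ∨
      {x : locus p | ψ.Realize x.1}ᶜ ∈ rightFilter h.strictTotalOrder hne.to_subtype := by
  obtain ⟨S, hS, hC, hD⟩ := h.finiteConvex ψ
  rw [hD]
  exact dichotomy _ _ hS hC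

/-- The right globalization `p_r` of the pair `(p, lt)`: the global type consisting of the formulas
`φ(x)` over `M` such that `φ(M) ∩ p(M)` is right-eventual in `(p(M), lt)`. -/
def rightGlobal [Nonempty M] {p : TypeOver L M A n} {lt : locus p → locus p → Prop}
    (h : IsWeaklyOMinimalPair p lt) (hne : (locus p).Nonempty) : GlobalType L M n where
  toTheory := {σ | RightEventual lt {x : locus p | (Formula.equivSentence.symm σ).Realize x.1}}
  subset' := (filter_isMaximal (fun x : locus p => x.1) _
    (rightFilter_neBot h.strictTotalOrder hne.to_subtype) (h.decides hne) fun _ => Iff.rfl).1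
  isMaximal' := (filter_isMaximal (fun x : locus p => x.1) _
    (rightFilter_neBot h.strictTotalOrder hne.to_subtype) (h.decides hne) fun _ => Iff.rfl).2

/-- The left globalization `p_l` of the pair `(p, lt)`: the global type consisting of the formulas
`φ(x)` over `M` such that `φ(M) ∩ p(M)` is left-eventual in `(p(M), lt)`. -/
def leftGlobal [Nonempty M] {p : TypeOver L M A n} {lt : locus p → locus p → Prop}
    (h : IsWeaklyOMinimalPair p lt) (hne : (locus p).Nonempty) : GlobalType L M n where
  toTheory := {σ | LeftEventual lt {x : locus p | (Formula.equivSentence.symm σ).Realize x.1}}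
  subset' := (rightGlobal h.reverse hne).subset'
  isMaximal' := (rightGlobal h.reverse hne).isMaximal'

/-- `B ◁ a`: the tuple `a` is right generic over the set `B`, that is, it realizes the restriction
of `p_r` to `A ∪ B`. -/
def RightGeneric [Nonempty M] {p : TypeOver L M A n} {lt : locus p → locus p → Prop}
    (h : IsWeaklyOMinimalPair p lt) (hne : (locus p).Nonempty) (B : Set M) (a : Fin n → M) : Prop :=
  RealizesRestriction (rightGlobal h hne) (A ∪ B) a

/-- `a ◁ b` for tuples `a` and `b`. -/
def Tri [Nonempty M] {p : TypeOver L M A n} {lt : locus p → locus p → Prop}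
    (h : IsWeaklyOMinimalPair p lt) (hne : (locus p).Nonempty) (a b : Fin n → M) : Prop :=
  RightGeneric h hne (Set.range a) b

/-- `(a i)` is a `◁`-increasing sequence of realizations of `p`. -/
def IsTriIncreasing [Nonempty M] {p : TypeOver L M A n} {lt : locus p → locus p → Prop}
    (h : IsWeaklyOMinimalPair p lt) (hne : (locus p).Nonempty) {I : Type*} [LinearOrder I]
    (a : I → Fin n → M) : Prop :=
  (∀ i, a i ∈ locus p) ∧ ∀ i j, i < j → Tri h hne (a i) (a j)

/-- `(a i)` is a `◁`-decreasing sequence of realizations of `p`. -/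
def IsTriDecreasing [Nonempty M] {p : TypeOver L M A n} {lt : locus p → locus p → Prop}
    (h : IsWeaklyOMinimalPair p lt) (hne : (locus p).Nonempty) {I : Type*} [LinearOrder I]
    (a : I → Fin n → M) : Prop :=
  (∀ i, a i ∈ locus p) ∧ ∀ i j, i < j → Tri h hne (a j) (a i)

end WeaklyOMinimal

end WeakOMin

set_option linter.unusedSectionVars false

/-! All seven conditions reduce to `FiniteIncreasingGeneric` for the pair or for its reverse: the
last term of a finite `◁`-increasing sequence is right generic over the earlier ones. Formulas have
finitely many parameters and finite increasing sequences extend to infinite ones, so the index order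
is irrelevant. Triviality is then the same condition, since Morley pairs are exactly `◁`-related
pairs; order-triviality agrees with it because `◁` is transitive (`tri_trans`).

It remains to pass from right to left. Saturation gives homogeneity
(`IsSaturated.exists_equivOver`), hence `p(M)` has no endpoints, `p_r` is invariant
(`fibre_mem_endFilter`), and generics over a small set form a final part
(`realizesRestriction_of_lt`). These yield the symmetry "`b` right generic over `a` iff `a` left
generic over `b`" (`realizesRestriction_reverse`). For a `◁`-decreasing `a 0, ..., a k`, compare `a
k` with some `d` left generic over `a 0, ..., a (k - 1)`. Both start `◁`-increasing sequences
continued by `a (k - 1), ..., a 0`; right genericity at each step determines the type of such a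
sequence, so `a k` and `d` have the same type over the other terms
(`FiniteIncreasingGeneric.reverse`). -/

namespace WeakOMin

/-! ### Definable sets, fibres and equality of types -/

section Definability

variable {L : FirstOrder.Language.{u, v}} {M : Type w} [L.Structure M]

variable (L) in
/-- The tuples `a` and `b` lie in the same `B`-definable sets. -/
def EquivOver (B : Set M) {α : Type*} (a b : α → M) : Prop :=
  ∀ D : Set (α → M), B.Definable L D → a ∈ D → b ∈ D

theorem EquivOver.symm {B : Set M} {α : Type*} {a b : α → M} (h : EquivOver L B a b) :
    EquivOver L B b a := fun D hD hb => by
  by_contra ha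
  exact h Dᶜ hD.compl ha hb

theorem EquivOver.mono {B C : Set M} {α : Type*} {a b : α → M} (h : EquivOver L C a b)
    (hBC : B ⊆ C) : EquivOver L B a b := fun D hD => h D (hD.mono hBC)

theorem EquivOver.comp {B : Set M} {α β : Type*} {a b : α → M} (h : EquivOver L B a b)
    (f : β → α) : EquivOver L B (a ∘ f) (b ∘ f) := fun _ hD => h _ (hD.preimage_comp f)

theorem equivOver_of_sameTypeOver {B : Set M} {m : ℕ} {a b : Fin m → M}
    (h : SameTypeOver (L := L) B a b) : EquivOver L B a b := by
  rintro D ⟨φ, rfl⟩ ha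
  exact (h φ).1 ha

/-- A set definable over `B` together with the entries of a tuple `b` is a fibre over `b` of a
`B`-definable set. -/
theorem exists_definable_fibre {B : Set M} {α β : Type*} {b : β → M} {D : Set (α → M)}
    (hD : (B ∪ Set.range b).Definable L D) :
    ∃ E : Set (α ⊕ β → M), B.Definable L E ∧ D = {x | Sum.elim x b ∈ E} := by
  classical
  obtain ⟨φ, rfl⟩ := Set.definable_iff_exists_formula_sum.1 hD
  have hc : ∀ c : (B ∪ Set.range b : Set M), c.1 ∉ B → ∃ j, b j = c.1 :=
    fun c hc => c.2.resolve_left hc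
  choose j hj using hc
  -- Parameters in `B` remain parameters; any other is an entry of `b` and becomes the corresponding
  -- variable.
  let g : (B ∪ Set.range b : Set M) ⊕ α → B ⊕ (α ⊕ β) :=
    Sum.elim (fun c => if h : c.1 ∈ B then Sum.inl ⟨c.1, h⟩ else Sum.inr (Sum.inr (j c h)))
      (fun i => Sum.inr (Sum.inl i))
  refine ⟨{y | (φ.relabel g).Realize (Sum.elim (↑) y)},
    Set.definable_iff_exists_formula_sum.2 ⟨φ.relabel g, rfl⟩, ?_⟩
  ext x
  simp only [Set.mem_ofPred_eq, Formula.realize_relabel]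
  refine iff_of_eq (congrArg _ ?_)
  funext i
  rcases i with c | i
  · by_cases h : c.1 ∈ B
    · simp [g, h]
    · simp [g, h, hj]
  · simp [g]

theorem definable_fibre {B : Set M} {α β : Type*} {E : Set (α ⊕ β → M)} (hE : B.Definable L E)
    (b : β → M) : (B ∪ Set.range b).Definable L {x : α → M | Sum.elim x b ∈ E} := by
  obtain ⟨φ, rfl⟩ := Set.definable_iff_exists_formula_sum.1 hE
  let g : B ⊕ (α ⊕ β) → (B ∪ Set.range b : Set M) ⊕ α :=
    Sum.elim (fun c => Sum.inl ⟨c.1, Or.inl c.2⟩)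
      (Sum.elim Sum.inr (fun k => Sum.inl ⟨b k, Or.inr ⟨k, rfl⟩⟩))
  refine Set.definable_iff_exists_formula_sum.2 ⟨φ.relabel g, ?_⟩
  ext x
  simp only [Set.mem_ofPred_eq, Formula.realize_relabel]
  refine iff_of_eq (congrArg _ ?_)
  funext i
  rcases i with c | i | i <;> simp [g]

theorem equivOver_union_range {B : Set M} {α β : Type*} {a a' : α → M} {b : β → M}
    (h : EquivOver L B (Sum.elim a b) (Sum.elim a' b)) :
    EquivOver L (B ∪ Set.range b) a a' := by
  intro D hD ha
  obtain ⟨E, hE, rfl⟩ := exists_definable_fibre hD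
  exact h E hE ha

theorem definable_ne {α : Type*} [Finite α] (a : α → M) :
    (Set.range a).Definable L ({a}ᶜ : Set (α → M)) := by
  refine Set.Definable.compl ?_
  have : ({a} : Set (α → M)) = ⋂ i, {x | x i = a i} := by
    ext x
    simp [funext_iff]
  rw [this]
  refine Set.definable_iInter_of_finite fun i => ?_
  exact ⟨(Term.var i).equal (L.con (⟨a i, i, rfl⟩ : Set.range a)).term, by
    ext x
    simp [Formula.realize_equal]⟩

instance liftFormula_isExpansionOn (B : Set M) :
    (L.lhomWithConstantsMap (Subtype.val : B → M)).IsExpansionOn M :=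
  have : (LHom.constantsOnMap (Subtype.val : B → M)).IsExpansionOn M :=
    constantsOnMap_isExpansionOn rfl
  LHom.sumMap_isExpansionOn _ _ _

theorem realize_liftFormula {B : Set M} {α : Type*} (φ : L[[B]].Formula α) (a : α → M) :
    (liftFormula φ).Realize a ↔ φ.Realize a :=
  LHom.realize_onFormula _ _

theorem realize_substParams {n m : ℕ} (φ : L[[M]].Formula (Fin n ⊕ Fin m)) (b : Fin m → M)
    (a : Fin n → M) : (substParams φ b).Realize a ↔ φ.Realize (Sum.elim a b) := by
  rw [substParams, Formula.Realize, BoundedFormula.realize_subst, Formula.Realize]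
  refine iff_of_eq (congrArg (fun z => BoundedFormula.Realize φ z _) ?_)
  funext i
  rcases i with i | i
  · rfl
  · rfl

end Definability

/-! ### Realizing filters and homogeneity in saturated structures -/

section Saturation

variable {L : FirstOrder.Language.{u, v}} {M : Type w} [L.Structure M]

theorem not_mem_type_iff {A : Set M} {n : ℕ} (p : TypeOver L M A n) (φ : L[[A]].Formula (Fin n)) :
    Formula.equivSentence φ ∉ p ↔ Formula.equivSentence φ.not ∈ p :=
  (p.not_mem_iff _).symm

/-- In a saturated structure the sets of a proper filter that are definable over a small set have a
common point. -/
theorem IsSaturated.exists_forall_mem_fin [Nonempty M] (hM : IsSaturated L M) {B : Set M}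
    (hB : #B < #M) {m : ℕ} (F : Filter (Fin m → M)) [F.NeBot] :
    ∃ x, ∀ D ∈ F, B.Definable L D → x ∈ D := by
  -- The formulas that hold on a set of `F` are finitely satisfiable in `M`, since finitely many
  -- sets of `F` meet; any completion of them is realized.
  let S : (L[[B]])[[Fin m]].Theory := {σ | {x | (Formula.equivSentence.symm σ).Realize x} ∈ F}
  have key : ∀ (σ : L[[B]][[Fin m]].Sentence) (x : Fin m → M),
      (Formula.equivSentence.symm σ).Realize x ↔
        @FirstOrder.Language.Sentence.Realize _ M
          (@FirstOrder.Language.withConstantsStructure L[[B]] M _ (Fin m)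
            (constantsOn.structure x)) σ :=
    fun σ x => Formula.realize_equivSentence_symm M σ x
  have hS : ((L[[B]].lhomWithConstants (Fin m)).onTheory (L[[B]].completeTheory M) ∪ S).IsSatisfiable := by
    rw [Theory.isSatisfiable_iff_isFinitelySatisfiable]
    intro T₀ hT₀
    have hmem : (⋂ σ ∈ T₀, {x | (Formula.equivSentence.symm σ).Realize x}) ∈ F := by
      refine (Filter.biInter_finset_mem T₀).2 fun σ hσ => ?_
      rcases hT₀ hσ with ⟨τ, hτ, rfl⟩ | h
      · refine Filter.univ_mem' fun x => (key _ x).2 ?_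
        let := constantsOn.structure x
        exact (LHom.realize_onSentence M (L[[B]].lhomWithConstants (Fin m)) τ).2 hτ
      · exact h
    obtain ⟨x, hx⟩ := Filter.nonempty_of_mem hmem
    let := constantsOn.structure x
    have : M ⊨ (T₀ : L[[B]][[Fin m]].Theory) :=
      ⟨fun σ hσ => (key σ x).1 (Set.mem_iInter₂.1 hx σ hσ)⟩
    exact Theory.Model.isSatisfiable M
  have hne : {q : TypeOver L M B m | S ⊆ ↑q}.Nonempty := by
    rw [Set.nonempty_iff_ne_empty, Ne, Theory.CompleteType.setOfPred_subset_eq_empty_iff]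
    exact not_not_intro hS
  obtain ⟨q, hq⟩ := hne
  obtain ⟨x, hx⟩ := hM B hB m q
  refine ⟨x, ?_⟩
  rintro D hDF ⟨φ, rfl⟩
  refine hx φ (hq ?_)
  change {x | (Formula.equivSentence.symm (Formula.equivSentence φ)).Realize x} ∈ F
  rw [Equiv.symm_apply_apply]
  exact hDF

theorem IsSaturated.exists_forall_mem [Nonempty M] (hM : IsSaturated L M) {B : Set M}
    (hB : #B < #M) {α : Type*} [Finite α] (F : Filter (α → M)) [F.NeBot] :
    ∃ x, ∀ D ∈ F, B.Definable L D → x ∈ D := by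
  obtain ⟨m, ⟨e⟩⟩ := Finite.exists_equiv_fin α
  obtain ⟨x, hx⟩ := hM.exists_forall_mem_fin hB (F.map fun y => y ∘ e.symm)
  refine ⟨x ∘ e, fun D hD hdef => hx _ ?_ (hdef.preimage_comp e)⟩
  rw [Filter.mem_map]
  convert hD using 1
  ext y
  simp [Function.comp_assoc]

theorem card_union_range_lt [Infinite M] {B : Set M} (hB : #B < #M) {α : Type*} [Finite α]
    (a : α → M) : #(B ∪ Set.range a : Set M) < #M :=
  (mk_union_le _ _).trans_lt (add_lt_of_lt (aleph0_le_mk M) hB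
    ((Set.finite_range a).lt_aleph0.trans_le (aleph0_le_mk M)))

/-- One step of homogeneity of a saturated structure. -/
theorem IsSaturated.exists_equivOver [Infinite M] (hM : IsSaturated L M) {B : Set M}
    (hB : #B < #M) {α β : Type*} [Finite α] [Finite β] {a b : α → M} (h : EquivOver L B a b)
    (c : β → M) : ∃ d : β → M, EquivOver L B (Sum.elim a c) (Sum.elim b d) := by
  -- The filter of conditions that `d` must meet: fibres over `b` of the `B`-definable sets
  -- containing `(a, c)`.
  let F : Filter (β → M) :=
    { sets := {G | ∃ D : Set (α ⊕ β → M), B.Definable L D ∧ Sum.elim a c ∈ D ∧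
        {x | Sum.elim b x ∈ D} ⊆ G}
      univ_sets := ⟨Set.univ, Set.definable_univ, trivial, Set.subset_univ _⟩
      sets_of_superset := by
        rintro G H ⟨D, h1, h2, h3⟩ hGH
        exact ⟨D, h1, h2, h3.trans hGH⟩
      inter_sets := by
        rintro G H ⟨D, h1, h2, h3⟩ ⟨E, k1, k2, k3⟩
        exact ⟨D ∩ E, h1.inter k1, ⟨h2, k2⟩, fun x hx => ⟨h3 hx.1, k3 hx.2⟩⟩ }
  have : F.NeBot := by
    refine Filter.neBot_iff.2 fun hbot => ?_
    obtain ⟨D, h1, h2, h3⟩ := (show (∅ : Set (β → M)) ∈ F by rw [hbot]; trivial)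
    -- The projection of `D` is `B`-definable and contains `a`, hence `b`; so the fibre over `b` is
    -- nonempty.
    have hex : b ∈ {x : α → M | ∃ y : β → M, Sum.elim x y ∈ D} :=
      h _ (h1.exists_of_finite) ⟨c, h2⟩
    obtain ⟨y, hy⟩ := hex
    exact h3 hy
  obtain ⟨d, hd⟩ := hM.exists_forall_mem (card_union_range_lt hB b) F
  refine ⟨d, fun D hD hac => ?_⟩
  refine hd {x | Sum.elim b x ∈ D} ⟨D, hD, hac, subset_rfl⟩ ?_
  have := definable_fibre (hD.preimage_comp (Sum.swap : α ⊕ β → β ⊕ α)) b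
  convert this using 1
  ext x
  refine iff_of_eq (congrArg (· ∈ D) ?_)
  funext i
  rcases i with i | i <;> rfl

end Saturation

/-! ### The set of realizations and its lack of endpoints -/

section Locus

variable {L : FirstOrder.Language.{u, v}} {M : Type w} [L.Structure M] {n : ℕ} {A : Set M}
  {p : TypeOver L M A n}

theorem mem_locus_of_equivOver {a b : Fin n → M} (ha : a ∈ locus p) (hab : EquivOver L A a b) :
    b ∈ locus p := fun φ hφ => hab _ ⟨φ, rfl⟩ (ha φ hφ)

theorem equivOver_of_mem_locus {a b : Fin n → M} (ha : a ∈ locus p) (hb : b ∈ locus p) :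
    EquivOver L A a b := by
  rintro D ⟨φ, rfl⟩ h
  refine hb φ ?_
  by_contra hφ
  exact (Formula.realize_not.1 (ha _ ((not_mem_type_iff p φ).1 hφ))) h

theorem top_mem_type (hne : (locus p).Nonempty) :
    Formula.equivSentence (⊤ : L[[A]].Formula (Fin n)) ∈ p := by
  obtain ⟨m, hm⟩ := hne
  by_contra hφ
  exact Formula.realize_not.1 (hm _ ((not_mem_type_iff p _).1 hφ)) (Formula.realize_top.2 trivial)

theorem infinite_of_isNonalgebraic (hne : (locus p).Nonempty) (hna : IsNonalgebraic p) :
    Infinite M := by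
  by_contra hfin
  rw [not_infinite_iff_finite] at hfin
  exact hna _ (top_mem_type hne) (Set.toFinite _)

variable {lt : locus p → locus p → Prop}

theorem IsWeaklyOMinimalPair.exists_definable (h : IsWeaklyOMinimalPair p lt) :
    ∃ E : Set (Fin n ⊕ Fin n → M), A.Definable L E ∧
      ∀ a b : locus p, lt a b ↔ Sum.elim a.1 b.1 ∈ E := by
  obtain ⟨φ, hφ⟩ := h.relDefinable
  exact ⟨_, ⟨φ, rfl⟩, hφ⟩

theorem IsWeaklyOMinimalPair.lt_of_equivOver (h : IsWeaklyOMinimalPair p lt) {a b c d : locus p}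
    (hab : lt a b) (he : EquivOver L A (Sum.elim a.1 b.1) (Sum.elim c.1 d.1)) : lt c d := by
  obtain ⟨E, hE, hlt⟩ := h.exists_definable
  exact (hlt c d).2 (he E hE ((hlt a b).1 hab))

theorem EquivOver.right {B : Set M} {α β : Type*} {a b : α → M} {c d : β → M}
    (h : EquivOver L B (Sum.elim a c) (Sum.elim b d)) : EquivOver L B c d :=
  h.comp Sum.inr

theorem EquivOver.swap {B : Set M} {α β : Type*} {a b : α → M} {c d : β → M}
    (h : EquivOver L B (Sum.elim a c) (Sum.elim b d)) :
    EquivOver L B (Sum.elim c a) (Sum.elim d b) := by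
  have h' := h.comp (Sum.swap : β ⊕ α → α ⊕ β)
  convert h' using 1 <;> · funext i; rcases i with i | i <;> rfl

/-- A non-algebraic type in a saturated structure has no greatest realization with respect to a
weakly o-minimal pair. -/
theorem IsWeaklyOMinimalPair.exists_lt [Nonempty M] [Infinite M] (hM : IsSaturated L M)
    (hA : #A < #M) (h : IsWeaklyOMinimalPair p lt) (hna : IsNonalgebraic p) (m : locus p) :
    ∃ x, lt m x := by
  by_contra hm
  push Not at hm
  have htop := top_mem_type ⟨_, m.2⟩
  -- Non-algebraicity makes `p` together with `x ≠ m` finitely satisfiable. If `m` were greatest, a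
  -- realization `x` of this would lie below `m`; moving `x` to `m` by homogeneity moves `m` to
  -- something above `m`.
  let F : Filter (Fin n → M) :=
    { sets := {G | ∃ φ : L[[A]].Formula (Fin n), Formula.equivSentence φ ∈ p ∧
        {x | φ.Realize x} ∩ {m.1}ᶜ ⊆ G}
      univ_sets := ⟨⊤, htop, Set.subset_univ _⟩
      sets_of_superset := by
        rintro G H ⟨φ, h1, h2⟩ hGH
        exact ⟨φ, h1, h2.trans hGH⟩
      inter_sets := by
        rintro G H ⟨φ, h1, h2⟩ ⟨ψ, k1, k2⟩
        refine ⟨φ ⊓ ψ, ?_, fun x hx => ?_⟩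
        · by_contra hφ
          exact Formula.realize_not.1 (m.2 _ ((not_mem_type_iff p _).1 hφ))
            (Formula.realize_inf.2 ⟨m.2 _ h1, m.2 _ k1⟩)
        · have := Formula.realize_inf.1 hx.1
          exact ⟨h2 ⟨this.1, hx.2⟩, k2 ⟨this.2, hx.2⟩⟩ }
  have : F.NeBot := by
    refine Filter.neBot_iff.2 fun hbot => ?_
    obtain ⟨φ, h1, h2⟩ := (show (∅ : Set (Fin n → M)) ∈ F by rw [hbot]; trivial)
    obtain ⟨x, hx, hxm⟩ := (hna φ h1).exists_notMem_finite (Set.finite_singleton m.1)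
    exact h2 ⟨hx, hxm⟩
  obtain ⟨x, hx⟩ := hM.exists_forall_mem (card_union_range_lt hA m.1) F
  have hxp : x ∈ locus p := fun φ hφ =>
    hx {x | φ.Realize x} ⟨φ, hφ, Set.inter_subset_left⟩
      (Set.Definable.mono ⟨φ, rfl⟩ Set.subset_union_left)
  have hxm : x ≠ m.1 := hx {m.1}ᶜ ⟨⊤, htop, Set.inter_subset_right⟩
    ((definable_ne m.1).mono Set.subset_union_right)
  have := h.strictTotalOrder
  have hlt : lt ⟨x, hxp⟩ m := by
    rcases trichotomous_of lt ⟨x, hxp⟩ m with h' | h' | h'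
    · exact h'
    · exact (hxm (congrArg Subtype.val h')).elim
    · exact (hm _ h').elim
  obtain ⟨y, hy⟩ := hM.exists_equivOver hA (equivOver_of_mem_locus hxp m.2) m.1
  exact hm ⟨y, mem_locus_of_equivOver m.2 hy.right⟩ (h.lt_of_equivOver hlt hy)

end Locus

/-! ### The filter of final parts and the type `p_r` -/

section EndFilter

variable {L : FirstOrder.Language.{u, v}} {M : Type w} [L.Structure M] [Nonempty M] {n : ℕ}
  {A : Set M} {p : TypeOver L M A n} {lt : locus p → locus p → Prop}

/-- The filter on `n`-tuples generated by the final parts of `p(M)`. -/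
def endFilter (h : IsWeaklyOMinimalPair p lt) (hne : (locus p).Nonempty) : Filter (Fin n → M) :=
  (rightFilter h.strictTotalOrder hne.to_subtype).map Subtype.val

variable (h : IsWeaklyOMinimalPair p lt) (hne : (locus p).Nonempty)

instance endFilter_neBot : (endFilter h hne).NeBot :=
  have := rightFilter_neBot h.strictTotalOrder hne.to_subtype
  Filter.map_neBot

/-- Without a greatest element, open final rays are nonempty and generate the same filter as closed
ones. -/
theorem mem_endFilter_iff (hmax : ∀ a, ∃ b, lt a b) {D : Set (Fin n → M)} :
    D ∈ endFilter h hne ↔ ∃ c, ∀ x, lt c x → x.1 ∈ D := by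
  refine (rightEventual_iff h.strictTotalOrder _).trans ⟨?_, ?_⟩
  · rintro ⟨c, hc⟩
    exact ⟨c, fun x hx => hc x (Or.inr hx)⟩
  · rintro ⟨c, hc⟩
    obtain ⟨d, hd⟩ := hmax c
    have := h.strictTotalOrder
    refine ⟨d, ?_⟩
    rintro x (rfl | hx)
    · exact hc _ hd
    · exact hc x (_root_.trans hd hx)

theorem locus_mem_endFilter : locus p ∈ endFilter h hne :=
  Filter.mem_map.2 (Filter.univ_mem' fun x => x.2)

theorem mem_or_compl_mem_endFilter {B : Set M} {D : Set (Fin n → M)} (hD : B.Definable L D) :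
    D ∈ endFilter h hne ∨ Dᶜ ∈ endFilter h hne := by
  obtain ⟨φ, rfl⟩ := hD
  have := h.decides hne (liftFormula φ)
  simp only [realize_liftFormula] at this
  exact this

theorem mem_rightGlobal_iff (φ : L[[M]].Formula (Fin n)) :
    Formula.equivSentence φ ∈ rightGlobal h hne ↔ {x | φ.Realize x} ∈ endFilter h hne := by
  change {x : locus p | (Formula.equivSentence.symm (Formula.equivSentence φ)).Realize x.1} ∈
    rightFilter h.strictTotalOrder hne.to_subtype ↔ _
  rw [Equiv.symm_apply_apply]
  rfl

/-- Replaces formulas and membership in `p_r` by definable sets and a filter, the language of all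
later arguments. -/
theorem realizesRestriction_rightGlobal_iff {B : Set M} {a : Fin n → M} :
    RealizesRestriction (rightGlobal h hne) B a ↔
      ∀ D ∈ endFilter h hne, B.Definable L D → a ∈ D := by
  simp only [RealizesRestriction, mem_rightGlobal_iff, realize_liftFormula]
  constructor
  · rintro ha D hD ⟨φ, rfl⟩
    exact ha φ hD
  · exact fun ha φ hφ => ha _ hφ ⟨φ, rfl⟩

theorem realizesRestriction_mono {B C : Set M} (hBC : B ⊆ C) {a : Fin n → M}
    (ha : RealizesRestriction (rightGlobal h hne) C a) :
    RealizesRestriction (rightGlobal h hne) B a := by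
  rw [realizesRestriction_rightGlobal_iff] at ha ⊢
  exact fun D hD hB => ha D hD (hB.mono hBC)

theorem realizesRestriction_of_finite {B : Set M} {a : Fin n → M}
    (ha : ∀ C : Finset M, (C : Set M) ⊆ B → RealizesRestriction (rightGlobal h hne) C a) :
    RealizesRestriction (rightGlobal h hne) B a := by
  simp only [realizesRestriction_rightGlobal_iff] at ha ⊢
  intro D hD hB
  obtain ⟨C, hCB, hC⟩ := Set.definable_iff_finitely_definable.1 hB
  exact ha C hCB D hD hC

theorem mem_locus_of_realizesRestriction {B : Set M} (hAB : A ⊆ B) {a : Fin n → M}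
    (ha : RealizesRestriction (rightGlobal h hne) B a) : a ∈ locus p := by
  rw [realizesRestriction_rightGlobal_iff] at ha
  intro φ hφ
  exact ha {x | φ.Realize x} (Filter.mem_of_superset (locus_mem_endFilter h hne)
    fun x hx => hx φ hφ) (Set.Definable.mono ⟨φ, rfl⟩ hAB)

/-- Weak o-minimality decides every definable set along the filter, so the restriction of `p_r` is
complete. -/
theorem equivOver_of_realizesRestriction {B : Set M} {a b : Fin n → M}
    (ha : RealizesRestriction (rightGlobal h hne) B a)
    (hb : RealizesRestriction (rightGlobal h hne) B b) : EquivOver L B a b := by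
  rw [realizesRestriction_rightGlobal_iff] at ha hb
  intro D hD haD
  rcases mem_or_compl_mem_endFilter h hne hD with h' | h'
  · exact hb D h' hD
  · exact (ha _ h' hD.compl haD).elim

theorem realizesRestriction_of_equivOver {B : Set M} {a b : Fin n → M}
    (ha : RealizesRestriction (rightGlobal h hne) B a) (hab : EquivOver L B a b) :
    RealizesRestriction (rightGlobal h hne) B b := by
  rw [realizesRestriction_rightGlobal_iff] at ha ⊢
  exact fun D hD hB => hab D hB (ha D hD hB)

theorem exists_realizesRestriction (hM : IsSaturated L M) {B : Set M} (hB : #B < #M) :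
    ∃ a, RealizesRestriction (rightGlobal h hne) B a := by
  obtain ⟨a, ha⟩ := hM.exists_forall_mem hB (endFilter h hne)
  exact ⟨a, (realizesRestriction_rightGlobal_iff h hne).2 ha⟩

/-- The ray above `b` is the trace of a set definable over `A` and `b`, and that set belongs to the
filter, so a generic must lie in it. -/
theorem lt_of_realizesRestriction (hmax : ∀ a, ∃ b, lt a b) {B : Set M} (hAB : A ⊆ B)
    {a : Fin n → M} (b : locus p) (hbB : Set.range b.1 ⊆ B)
    (ha : RealizesRestriction (rightGlobal h hne) B a) :
    lt b ⟨a, mem_locus_of_realizesRestriction h hne hAB ha⟩ := by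
  obtain ⟨E, hE, hlt⟩ := h.exists_definable
  rw [hlt]
  have hE' := definable_fibre (hE.preimage_comp (Sum.swap : Fin n ⊕ Fin n → Fin n ⊕ Fin n)) b.1
  have key : ∀ x : Fin n → M,
      Sum.elim x b.1 ∘ (Sum.swap : Fin n ⊕ Fin n → Fin n ⊕ Fin n) = Sum.elim b.1 x := by
    intro x
    funext i
    rcases i with i | i <;> rfl
  have := (realizesRestriction_rightGlobal_iff h hne).1 ha _ ?_
    (hE'.mono (Set.union_subset hAB hbB))
  · rw [← key]
    exact this
  · refine (mem_endFilter_iff h hne hmax).2 ⟨b, fun x hx => ?_⟩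
    change Sum.elim x.1 b.1 ∘ (Sum.swap : Fin n ⊕ Fin n → Fin n ⊕ Fin n) ∈ E
    rw [key]
    exact (hlt b x).1 hx

end EndFilter

/-! ### Invariance of `p_r` and symmetry of genericity -/

section Invariance

variable {L : FirstOrder.Language.{u, v}} {M : Type w} [L.Structure M] [Nonempty M] [Infinite M]
  {n : ℕ} {A : Set M} {p : TypeOver L M A n} {lt : locus p → locus p → Prop}

/-- Invariance at the level of sets. If the fibre over `b` contains the ray above `c`, choose `c'`
so that `(b, c)` and `(b', c')` have the same type over `B`; homogeneity pulls each `x` above `c'`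
back to some `y` above `c`, so `x` lies in the fibre over `b'`. -/
theorem fibre_mem_endFilter (h : IsWeaklyOMinimalPair p lt) (hne : (locus p).Nonempty)
    (hM : IsSaturated L M) (hmax : ∀ a, ∃ b, lt a b) {B : Set M} (hAB : A ⊆ B) (hB : #B < #M)
    {α : Type*} [Finite α] {E : Set (Fin n ⊕ α → M)} (hE : B.Definable L E) {b b' : α → M}
    (hbb : EquivOver L B b b') (hb : {x | Sum.elim x b ∈ E} ∈ endFilter h hne) :
    {x | Sum.elim x b' ∈ E} ∈ endFilter h hne := by
  rw [mem_endFilter_iff h hne hmax] at hb ⊢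
  obtain ⟨c, hc⟩ := hb
  obtain ⟨c', hc'⟩ := hM.exists_equivOver hB hbb c.1
  refine ⟨⟨c', mem_locus_of_equivOver c.2 (hc'.right.mono hAB)⟩, fun x hx => ?_⟩
  obtain ⟨y, hy⟩ := hM.exists_equivOver hB hc'.symm x.1
  have hyp : y ∈ locus p := mem_locus_of_equivOver x.2 (hy.right.mono hAB)
  have hlt : lt c ⟨y, hyp⟩ := by
    refine h.lt_of_equivOver hx ?_
    have := (hy.comp (Sum.map Sum.inr id : Fin n ⊕ Fin n → _)).mono hAB
    convert this using 1 <;> · funext i; rcases i with i | i <;> rfl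
  have h2 := hy.symm.comp (Sum.elim Sum.inr (Sum.inl ∘ Sum.inl) : Fin n ⊕ α → _)
  have h3 := h2 E hE
  have e1 : (Sum.elim (Sum.elim b c.1) y ∘ (Sum.elim Sum.inr (Sum.inl ∘ Sum.inl) : Fin n ⊕ α → _))
    = Sum.elim y b := by funext i; rcases i with i | i <;> rfl
  have e2 : (Sum.elim (Sum.elim b' c') x.1 ∘
      (Sum.elim Sum.inr (Sum.inl ∘ Sum.inl) : Fin n ⊕ α → _)) = Sum.elim x.1 b' := by
    funext i; rcases i with i | i <;> rfl
  rw [e1, e2] at h3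
  exact h3 (hc _ hlt)

variable (h : IsWeaklyOMinimalPair p lt) (hne : (locus p).Nonempty)

theorem isInvariant_rightGlobal (hM : IsSaturated L M) (hA : #A < #M)
    (hmax : ∀ a, ∃ b, lt a b) : IsInvariant (rightGlobal h hne) A := by
  intro m φ b₁ b₂ hb
  have h12 := equivOver_of_sameTypeOver hb
  rw [mem_rightGlobal_iff]
  simp only [Formula.realize_iff, realize_substParams, realize_liftFormula]
  have hdef : A.Definable L {x | φ.Realize x} := ⟨φ, rfl⟩
  rcases mem_or_compl_mem_endFilter h hne (definable_fibre hdef b₁) with h' | h'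
  · filter_upwards [h', fibre_mem_endFilter h hne hM hmax subset_rfl hA hdef h12 h'] with x h1 h2
    exact iff_of_true h1 h2
  · filter_upwards [h', fibre_mem_endFilter h hne hM hmax subset_rfl hA hdef.compl h12 h']
      with x h1 h2
    exact iff_of_false h1 h2

theorem isNonalgebraicGlobal_rightGlobal (hmax : ∀ a, ∃ b, lt a b) :
    IsNonalgebraicGlobal (rightGlobal h hne) := by
  classical
  intro φ hφ
  rw [mem_rightGlobal_iff, mem_endFilter_iff h hne hmax] at hφ
  obtain ⟨c, hc⟩ := hφ
  have := h.strictTotalOrder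
  -- A strictly increasing sequence above `c` shows that the final ray is infinite.
  obtain ⟨f, hf, hff⟩ := exists_seq_of_forall_finset_exists (fun x => lt c x) lt (by
    intro s
    induction s using Finset.induction_on with
    | empty =>
      intro _
      obtain ⟨y, hy⟩ := hmax c
      exact ⟨y, hy, by simp⟩
    | insert a s _ ih =>
      intro hs
      obtain ⟨y, hy, hys⟩ := ih fun x hx => hs x (Finset.mem_insert_of_mem hx)
      have hca := hs a (Finset.mem_insert_self a s)
      rcases trichotomous_of lt a y with hay | rfl | hya
      · exact ⟨y, hy, fun x hx => (Finset.mem_insert.1 hx).elim (fun e => e ▸ hay) (hys x)⟩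
      all_goals
        obtain ⟨z, hz⟩ := hmax a
        refine ⟨z, _root_.trans hca hz, fun x hx => ?_⟩
        rcases Finset.mem_insert.1 hx with rfl | hx
        · exact hz
        · first
          | exact _root_.trans (hys x hx) hz
          | exact _root_.trans (hys x hx) (_root_.trans hya hz))
  refine (Set.infinite_range_of_injective (f := fun i => (f i).1) fun i j hij => ?_).mono ?_
  · have hij' : f i = f j := Subtype.ext hij
    rcases lt_trichotomy i j with hl | hl | hl
    · exact (irrefl_of lt (f j) (hij' ▸ hff i j hl)).elim
    · exact hl
    · exact (irrefl_of lt (f j) (hij' ▸ hff j i hl)).elim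
  · rintro _ ⟨i, rfl⟩
    exact hc _ (hf i)

variable {h hne}

theorem realizesRestriction_of_equivOver_elim (hM : IsSaturated L M) (hA : #A < #M)
    (hmax : ∀ a, ∃ b, lt a b) {α : Type*} [Finite α] {a a' : Fin n → M} {b b' : α → M}
    (ha : RealizesRestriction (rightGlobal h hne) (A ∪ Set.range b) a)
    (he : EquivOver L A (Sum.elim a b) (Sum.elim a' b')) :
    RealizesRestriction (rightGlobal h hne) (A ∪ Set.range b') a' := by
  rw [realizesRestriction_rightGlobal_iff] at ha ⊢
  intro D hD hdef
  obtain ⟨E, hE, rfl⟩ := exists_definable_fibre hdef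
  exact he E hE (ha {x | Sum.elim x b ∈ E}
    (fibre_mem_endFilter h hne hM hmax subset_rfl hA hE he.right.symm hD) (definable_fibre hE b))

/-- By invariance, which fibres are large depends only on the type of `b` over `B`; hence that type
determines the type of `(a, b)` for `a` generic over `b`. -/
theorem equivOver_elim_of_realizesRestriction (hM : IsSaturated L M)
    (hmax : ∀ a, ∃ b, lt a b) {B : Set M} (hAB : A ⊆ B) (hB : #B < #M) {α : Type*} [Finite α]
    {a a' : Fin n → M} {b b' : α → M}
    (ha : RealizesRestriction (rightGlobal h hne) (B ∪ Set.range b) a)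
    (ha' : RealizesRestriction (rightGlobal h hne) (B ∪ Set.range b') a')
    (hbb : EquivOver L B b b') : EquivOver L B (Sum.elim a b) (Sum.elim a' b') := by
  rw [realizesRestriction_rightGlobal_iff] at ha ha'
  intro E hE haE
  rcases mem_or_compl_mem_endFilter h hne (definable_fibre hE b) with h' | h'
  · exact ha' _ (fibre_mem_endFilter h hne hM hmax hAB hB hE hbb h') (definable_fibre hE b')
  · exact (ha _ h' (definable_fibre hE b).compl haE).elim

/-- The realizations of `p_r` restricted to a small set form a final part of `p(M)`. -/
theorem realizesRestriction_of_lt (hM : IsSaturated L M)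
    (hmax : ∀ a, ∃ b, lt a b) {B : Set M} (hAB : A ⊆ B) (hB : #B < #M) {a a' : locus p}
    (ha : RealizesRestriction (rightGlobal h hne) B a.1) (haa : lt a a') :
    RealizesRestriction (rightGlobal h hne) B a'.1 := by
  refine (realizesRestriction_rightGlobal_iff h hne).2 fun D hD hdef => ?_
  obtain ⟨c, hc⟩ := (mem_endFilter_iff h hne hmax).1 hD
  -- This `d` has the type of `a` over `B` but lies above `c`. Copying `a'` to `d'` along `a ↦ d`
  -- gives `c < d < d'`, so `d'` is in `D`, and therefore so is `a'`.
  obtain ⟨d, hd⟩ := exists_realizesRestriction h hne hM (card_union_range_lt hB c.1)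
  have hABc : A ⊆ B ∪ Set.range c.1 := hAB.trans Set.subset_union_left
  have hcd := lt_of_realizesRestriction h hne hmax hABc c Set.subset_union_right hd
  have hda := equivOver_of_realizesRestriction h hne ha
    (realizesRestriction_mono h hne Set.subset_union_left hd)
  obtain ⟨d', hd'⟩ := hM.exists_equivOver hB hda a'.1
  have hdp : d' ∈ locus p := mem_locus_of_equivOver a'.2 (hd'.right.mono hAB)
  have hdd : lt ⟨d, mem_locus_of_realizesRestriction h hne hABc hd⟩ ⟨d', hdp⟩ :=
    h.lt_of_equivOver haa (hd'.mono hAB)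
  have := h.strictTotalOrder
  exact hd'.right.symm D hdef (hc ⟨d', hdp⟩ (_root_.trans hcd hdd))

/-- Symmetry of genericity: if `b` is right generic over `a`, then `a` is left generic over `b`. -/
theorem realizesRestriction_reverse (hM : IsSaturated L M) (hA : #A < #M)
    (hmax : ∀ a, ∃ b, lt a b) (hmin : ∀ a, ∃ b, lt b a) {a b : Fin n → M} (ha : a ∈ locus p)
    (hab : RealizesRestriction (rightGlobal h hne) (A ∪ Set.range a) b) :
    RealizesRestriction (rightGlobal h.reverse hne) (A ∪ Set.range b) a := by
  have hb : b ∈ locus p := mem_locus_of_realizesRestriction h hne Set.subset_union_left hab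
  -- With `c` left generic over `b`, let `(c, x)` be a copy of `(b, a)`. Then `x < c < b`: `b` is
  -- right generic over `x` because `c` is, and `x` is left generic over `b` because `c` is. Finally
  -- `(b, x)` and `(b, a)` have the same type.
  obtain ⟨c, hc⟩ := exists_realizesRestriction h.reverse hne hM (card_union_range_lt hA b)
  have hcp := mem_locus_of_realizesRestriction h.reverse hne Set.subset_union_left hc
  have hcb := lt_of_realizesRestriction h.reverse hne hmin Set.subset_union_left ⟨b, hb⟩
    Set.subset_union_right hc
  obtain ⟨x, hx⟩ := hM.exists_equivOver hA (equivOver_of_mem_locus hb hcp) a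
  have hxp := mem_locus_of_equivOver ha hx.right
  have hxc := realizesRestriction_of_equivOver_elim hM hA hmax hab hx
  have hxltc := lt_of_realizesRestriction h hne hmax Set.subset_union_left ⟨x, hxp⟩
    Set.subset_union_right hxc
  have hxb := realizesRestriction_of_lt (a := ⟨c, hcp⟩) (a' := ⟨b, hb⟩) hM hmax
    Set.subset_union_left (card_union_range_lt hA x) hxc hcb
  have hbx := realizesRestriction_of_lt (a := ⟨c, hcp⟩) (a' := ⟨x, hxp⟩) hM hmin
    Set.subset_union_left (card_union_range_lt hA b) hc hxltc
  exact realizesRestriction_of_equivOver_elim hM hA hmin hbx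
    (equivOver_elim_of_realizesRestriction hM hmax subset_rfl hA hxb hab
      (equivOver_of_mem_locus hxp ha)).swap

end Invariance

/-! ### Generic finite sequences and triviality -/

section Triviality

variable {L : FirstOrder.Language.{u, v}} {M : Type w} [L.Structure M] [Nonempty M]
  {n : ℕ} {A : Set M} {p : TypeOver L M A n} {lt : locus p → locus p → Prop}
  {h : IsWeaklyOMinimalPair p lt} {hne : (locus p).Nonempty}

theorem realizesRestriction_of_mem_locus {a : Fin n → M} (ha : a ∈ locus p) :
    RealizesRestriction (rightGlobal h hne) A a := by
  refine (realizesRestriction_rightGlobal_iff h hne).2 fun D hD hdef => ?_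
  obtain ⟨x, hxD, hx⟩ := Filter.nonempty_of_mem
    (Filter.inter_mem hD (locus_mem_endFilter h hne))
  exact equivOver_of_mem_locus hx ha D hdef hxD

theorem mem_locus_of_tri {a b : Fin n → M} (hab : Tri h hne a b) : b ∈ locus p :=
  mem_locus_of_realizesRestriction h hne Set.subset_union_left hab

theorem isMorley_pair_iff {a b : Fin n → M} :
    IsMorley (rightGlobal h hne) A ![a, b] ↔ a ∈ locus p ∧ Tri h hne a b := by
  rw [IsMorley, Fin.forall_fin_two]
  have e0 : (⋃ j, ⋃ _ : j < (0 : Fin 2), Set.range ((![a, b] : Fin 2 → Fin n → M) j)) = ∅ := by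
    simp
  have e1 : (⋃ j, ⋃ _ : j < (1 : Fin 2), Set.range ((![a, b] : Fin 2 → Fin n → M) j)) =
      Set.range a := by
    ext x
    simp
  rw [e0, e1]
  refine and_congr ⟨mem_locus_of_realizesRestriction h hne Set.subset_union_left, fun ha => ?_⟩
    Iff.rfl
  rw [Set.union_empty]
  exact realizesRestriction_of_mem_locus ha

theorem card_union_lt [Infinite M] (hA : #A < #M) {C : Set M} (hC : C.Finite) :
    #(A ∪ C : Set M) < #M :=
  (mk_union_le _ _).trans_lt (add_lt_of_lt (aleph0_le_mk M) hA
    (hC.lt_aleph0.trans_le (aleph0_le_mk M)))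

/-- `c` lies above `b`, and the generics over `a` form a final part. -/
theorem tri_trans [Infinite M] (hM : IsSaturated L M) (hA : #A < #M) (hmax : ∀ a, ∃ b, lt a b)
    {a b c : Fin n → M} (hab : Tri h hne a b) (hbc : Tri h hne b c) : Tri h hne a c :=
  realizesRestriction_of_lt (a := ⟨b, mem_locus_of_tri hab⟩) (a' := ⟨c, mem_locus_of_tri hbc⟩)
    hM hmax Set.subset_union_left (card_union_range_lt hA a) hab
    (lt_of_realizesRestriction h hne hmax Set.subset_union_left ⟨b, mem_locus_of_tri hab⟩
      Set.subset_union_right hbc)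

theorem tri_reverse_iff [Infinite M] (hM : IsSaturated L M) (hA : #A < #M)
    (hmax : ∀ a, ∃ b, lt a b) (hmin : ∀ a, ∃ b, lt b a) {a b : Fin n → M} (ha : a ∈ locus p)
    (hb : b ∈ locus p) : Tri h.reverse hne a b ↔ Tri h hne b a :=
  ⟨fun hab => realizesRestriction_reverse (h := h.reverse) hM hA hmin hmax ha hab,
    fun hba => realizesRestriction_reverse (h := h) hM hA hmax hmin hb hba⟩

theorem isTriIncreasing_reverse_iff [Infinite M] (hM : IsSaturated L M) (hA : #A < #M)
    (hmax : ∀ a, ∃ b, lt a b) (hmin : ∀ a, ∃ b, lt b a) {I : Type*} [LinearOrder I]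
    {a : I → Fin n → M} : IsTriIncreasing h.reverse hne a ↔ IsTriDecreasing h hne a :=
  and_congr_right fun ha => forall_congr' fun i => forall_congr' fun j =>
    imp_congr_right fun _ => tri_reverse_iff hM hA hmax hmin (ha i) (ha j)

variable (h hne) in
/-- The last term of every finite `◁`-increasing sequence of realizations of `p` is right generic
over the preceding terms. -/
def FiniteIncreasingGeneric : Prop :=
  ∀ (a : ℕ → Fin n → M) (k : ℕ), (∀ i ≤ k, a i ∈ locus p) →
    (∀ i j, i < j → j ≤ k → Tri h hne (a i) (a j)) →
    RightGeneric h hne (⋃ j, ⋃ _ : j < k, Set.range (a j)) (a k)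

theorem finite_iUnion_range {a : ℕ → Fin n → M} {P : ℕ → Prop} (hP : {j | P j}.Finite) :
    (⋃ j, ⋃ _ : P j, Set.range (a j)).Finite :=
  hP.biUnion fun j _ => Set.finite_range (a j)

theorem subset_iUnion_range {I : Type*} {a : I → Fin n → M} {P : I → Prop} {i : I} (hi : P i) :
    Set.range (a i) ⊆ ⋃ j, ⋃ _ : P j, Set.range (a j) :=
  Set.subset_iUnion₂_of_subset i hi subset_rfl

theorem finiteIncreasingGeneric_of_forall_nat [Infinite M] (hM : IsSaturated L M) (hA : #A < #M)
    (H : ∀ a : ℕ → Fin n → M, IsTriIncreasing h hne a → IsMorley (rightGlobal h hne) A a) :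
    FiniteIncreasingGeneric h hne := by
  intro a k hap hak
  -- The finite sequence is prolonged to an infinite `◁`-increasing one by adding elements generic
  -- over everything chosen before.
  obtain ⟨f, hf, hff⟩ := exists_seq_of_forall_finset_exists
    (fun x => x ∈ locus p ∧ ∀ i ≤ k, Tri h hne (a i) x) (Tri h hne) (by
      intro s _
      have hfin : ((⋃ i, ⋃ _ : i ≤ k, Set.range (a i)) ∪
          ⋃ y ∈ s, Set.range y : Set M).Finite :=
        (finite_iUnion_range (Set.finite_le_nat k)).union
          (s.finite_toSet.biUnion fun y _ => Set.finite_range y)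
      obtain ⟨x, hx⟩ := exists_realizesRestriction h hne hM (card_union_lt hA hfin)
      refine ⟨x, ⟨mem_locus_of_realizesRestriction h hne Set.subset_union_left hx,
        fun i hi => ?_⟩, fun y hy => ?_⟩
      · exact realizesRestriction_mono h hne (Set.union_subset_union_right _
          ((subset_iUnion_range (P := (· ≤ k)) hi).trans Set.subset_union_left)) hx
      · exact realizesRestriction_mono h hne (Set.union_subset_union_right _
          ((Set.subset_iUnion₂_of_subset y hy subset_rfl).trans Set.subset_union_right)) hx)
  let b : ℕ → Fin n → M := fun i => if i ≤ k then a i else f (i - k)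
  have hle : ∀ i ≤ k, b i = a i := fun i hi => if_pos hi
  have hgt : ∀ i, ¬ i ≤ k → b i = f (i - k) := fun i hi => if_neg hi
  have hb : IsTriIncreasing h hne b := by
    refine ⟨fun i => ?_, fun i j hij => ?_⟩
    · by_cases hi : i ≤ k
      · rw [hle i hi]
        exact hap i hi
      · rw [hgt i hi]
        exact (hf _).1
    · by_cases hj : j ≤ k
      · rw [hle j hj, hle i (hij.le.trans hj)]
        exact hak i j hij hj
      · rw [hgt j hj]
        by_cases hi : i ≤ k
        · rw [hle i hi]
          exact (hf _).2 i hi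
        · rw [hgt i hi]
          exact hff _ _ (by omega)
  have hmor := H b hb k
  rw [hle k le_rfl] at hmor
  refine realizesRestriction_mono h hne (Set.union_subset_union_right _ ?_) hmor
  refine Set.iUnion₂_subset fun j hj => ?_
  rw [← hle j hj.le]
  exact subset_iUnion_range (P := (· < k)) hj

/-- A formula involves finitely many parameters, hence finitely many indices below `i`; listed in
increasing order and followed by `i`, they give a finite sequence. -/
theorem FiniteIncreasingGeneric.isMorley (H : FiniteIncreasingGeneric h hne) {I : Type*}
    [LinearOrder I] {a : I → Fin n → M} (ha : IsTriIncreasing h hne a) :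
    IsMorley (rightGlobal h hne) A a := by
  intro i
  refine realizesRestriction_of_finite h hne fun C hC => ?_
  have hCA : (C : Set M) \ A ⊆ ⋃ j : Set.Iio i, Set.range (a j) := by
    rintro c ⟨hc, hcA⟩
    obtain ⟨j, hj, hcj⟩ := Set.mem_iUnion₂.1 ((hC hc).resolve_left hcA)
    exact Set.mem_iUnion.2 ⟨⟨j, hj⟩, hcj⟩
  obtain ⟨J, hJ, hCJ⟩ := Set.finite_subset_iUnion (C.finite_toSet.subset Set.sdiff_subset) hCA
  lift J to Finset (Set.Iio i) using hJ
  let e := J.orderEmbOfFin rfl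
  -- The default `a i` serves as the last term, at index `J.card`; larger indices play no role.
  let b : ℕ → Fin n → M := fun m => if hm : m < J.card then a (e ⟨m, hm⟩) else a i
  have hlt : ∀ m (hm : m < J.card), b m = a (e ⟨m, hm⟩) := fun m hm => dif_pos hm
  have hge : b J.card = a i := dif_neg (lt_irrefl _)
  have hgen := H b J.card (fun m hm => ?_) (fun l m hlm hm => ?_)
  · rw [hge] at hgen
    refine realizesRestriction_mono h hne (fun c hc => ?_) hgen
    by_cases hcA : c ∈ A
    · exact Or.inl hcA
    · obtain ⟨j, hj, hcj⟩ := Set.mem_iUnion₂.1 (hCJ ⟨hc, hcA⟩)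
      obtain ⟨m, rfl⟩ : j ∈ Set.range e := by
        rw [Finset.range_orderEmbOfFin]
        exact hj
      refine Or.inr (Set.mem_iUnion₂.2 ⟨m.1, m.2, ?_⟩)
      rw [hlt m.1 m.2]
      exact hcj
  · rcases hm.lt_or_eq with hm | rfl
    · rw [hlt m hm]
      exact ha.1 _
    · rw [hge]
      exact ha.1 _
  · rw [hlt l (hlm.trans_le hm)]
    rcases hm.lt_or_eq with hm | rfl
    · rw [hlt m hm]
      exact ha.2 _ _ (e.lt_iff_lt.2 hlm)
    · rw [hge]
      exact ha.2 _ _ (e _).2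

/-- If finite `◁`-increasing sequences are right generic, then finite `◁`-decreasing sequences are
left generic. -/
theorem FiniteIncreasingGeneric.reverse [Infinite M] (hM : IsSaturated L M) (hA : #A < #M)
    (hmax : ∀ a, ∃ b, lt a b) (hmin : ∀ a, ∃ b, lt b a) (H : FiniteIncreasingGeneric h hne) :
    FiniteIncreasingGeneric h.reverse hne := by
  intro a k hap hak
  have htri : ∀ i j, i < j → j ≤ k → Tri h hne (a j) (a i) := fun i j hij hj =>
    (tri_reverse_iff hM hA hmax hmin (hap i (hij.le.trans hj)) (hap j hj)).1 (hak i j hij hj)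
  obtain ⟨d, hd⟩ := exists_realizesRestriction h.reverse hne hM
    (card_union_lt hA (finite_iUnion_range (a := a) (Set.finite_lt_nat k)))
  have hdp := mem_locus_of_realizesRestriction h.reverse hne Set.subset_union_left hd
  have hdtri : ∀ j < k, Tri h hne d (a j) := fun j hj =>
    (tri_reverse_iff hM hA hmax hmin (hap j hj.le) hdp).1
      (realizesRestriction_mono h.reverse hne (Set.union_subset_union_right _
        (subset_iUnion_range (P := (· < k)) hj)) hd)
  -- The entries of the `m` terms just before `a k`.
  let C : ℕ → Set M := fun m => ⋃ j, ⋃ _ : k - m ≤ j ∧ j < k, Set.range (a j)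
  have hCfin : ∀ m, (C m).Finite := fun m =>
    finite_iUnion_range ((Set.finite_lt_nat k).subset fun j hj => hj.2)
  have hgen : ∀ m < k, ∀ x ∈ locus p, (∀ j < k, Tri h hne x (a j)) →
      RealizesRestriction (rightGlobal h hne) ((A ∪ C m) ∪ Set.range x) (a (k - (m + 1))) := by
    intro m hm x hx hxa
    -- The increasing sequence `x, a (k - 1), a (k - 2), ...`, used up to index `m + 1`; `x` will be
    -- `d` and then `a k`.
    let s : ℕ → Fin n → M := fun i => if i = 0 then x else a (k - i)
    have hs : ∀ i, i ≠ 0 → s i = a (k - i) := fun i hi => if_neg hi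
    have hs0 : s 0 = x := if_pos rfl
    have hgen := H s (m + 1) (fun i hi => ?_) (fun i j hij hj => ?_)
    · rw [hs _ m.succ_ne_zero] at hgen
      refine realizesRestriction_mono h hne ?_ hgen
      rw [Set.union_assoc]
      refine Set.union_subset_union_right _ (Set.union_subset ?_ ?_)
      · refine Set.iUnion₂_subset fun j hj => ?_
        have e : a j = s (k - j) := by
          rw [hs _ (by omega), Nat.sub_sub_self hj.2.le]
        rw [e]
        exact subset_iUnion_range (P := (· < m + 1)) (by omega)
      · rw [← hs0]
        exact subset_iUnion_range (P := (· < m + 1)) m.succ_pos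
    · by_cases h0 : i = 0
      · rw [h0, hs0]
        exact hx
      · rw [hs i h0]
        exact hap _ (by omega)
    · rw [hs j (by omega)]
      by_cases h0 : i = 0
      · rw [h0, hs0]
        exact hxa _ (by omega)
      · rw [hs i h0]
        exact htri _ _ (by omega) (by omega)
  have key : ∀ m ≤ k, EquivOver L (A ∪ C m) d (a k) := by
    intro m
    induction m with
    | zero =>
      intro _
      have : C 0 = ∅ := by
        refine Set.subset_empty_iff.1 (Set.iUnion₂_subset fun j hj => ?_)
        omega
      rw [this, Set.union_empty]
      exact equivOver_of_mem_locus hdp (hap k le_rfl)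
    | succ m ih =>
      intro hm
      -- The new term is right generic over both `d` and `a k` together with `C m`, so the two pairs
      -- have the same type over `A ∪ C m`; the common term then joins the parameters.
      have h1 := equivOver_elim_of_realizesRestriction hM hmax Set.subset_union_left
        (card_union_lt hA (hCfin m)) (hgen m hm d hdp hdtri)
        (hgen m hm (a k) (hap k le_rfl) fun j hj => htri j k hj le_rfl) (ih (Nat.le_of_succ_le hm))
      refine (equivOver_union_range h1.swap).mono ?_
      rw [Set.union_assoc]
      refine Set.union_subset_union_right _ (Set.iUnion₂_subset fun j hj => ?_)
      by_cases hj' : k - m ≤ j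
      · exact (subset_iUnion_range (P := fun j => k - m ≤ j ∧ j < k) ⟨hj', hj.2⟩).trans
          Set.subset_union_left
      · rw [show j = k - (m + 1) by omega]
        exact Set.subset_union_right
  refine realizesRestriction_of_equivOver h.reverse hne hd ((key k le_rfl).mono ?_)
  refine Set.union_subset_union_right _ (Set.iUnion₂_subset fun j hj => ?_)
  exact subset_iUnion_range (P := fun j => k - k ≤ j ∧ j < k) ⟨by omega, hj⟩

theorem finiteIncreasingGeneric_iff_forall_nat [Infinite M] (hM : IsSaturated L M)
    (hA : #A < #M) : FiniteIncreasingGeneric h hne ↔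
      ∀ a : ℕ → Fin n → M, IsTriIncreasing h hne a → IsMorley (rightGlobal h hne) A a :=
  ⟨fun H _ ha => H.isMorley ha, finiteIncreasingGeneric_of_forall_nat hM hA⟩

theorem finiteIncreasingGeneric_iff_forall_linearOrder [Infinite M] (hM : IsSaturated L M)
    (hA : #A < #M) : FiniteIncreasingGeneric h hne ↔
      ∀ (I : Type t) [LinearOrder I] (a : I → Fin n → M),
        IsTriIncreasing h hne a → IsMorley (rightGlobal h hne) A a := by
  refine ⟨fun H I _ a ha => H.isMorley ha, fun H => ?_⟩
  refine finiteIncreasingGeneric_of_forall_nat hM hA fun a ha i => ?_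
  -- The index orders range over a fixed universe, so `ℕ` is lifted into it.
  have hmor := H (ULift.{t} ℕ) (fun j => a j.down) ⟨fun j => ha.1 _, fun j k hjk => ha.2 _ _ hjk⟩
    ⟨i⟩
  refine realizesRestriction_mono h hne (Set.union_subset_union_right _ ?_) hmor
  refine Set.iUnion₂_subset fun j hj => ?_
  exact subset_iUnion_range (a := fun j : ULift.{t} ℕ => a j.down) (P := (· < ⟨i⟩)) (i := ⟨j⟩) hj

theorem isTriIncreasing_of_isMorley_pairs {a : ℕ → Fin n → M}
    (ha : ∀ i j, i < j → IsMorley (rightGlobal h hne) A ![a i, a j]) :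
    IsTriIncreasing h hne a :=
  ⟨fun i => (isMorley_pair_iff.1 (ha i (i + 1) i.lt_succ_self)).1,
    fun i j hij => (isMorley_pair_iff.1 (ha i j hij)).2⟩

theorem finiteIncreasingGeneric_iff_isTrivialOver [Infinite M] (hM : IsSaturated L M)
    (hA : #A < #M) (hmax : ∀ a, ∃ b, lt a b) :
    FiniteIncreasingGeneric h hne ↔ IsTrivialOver (rightGlobal h hne) A := by
  constructor
  · exact fun H => ⟨isNonalgebraicGlobal_rightGlobal h hne hmax,
      isInvariant_rightGlobal h hne hM hA hmax,
      fun a ha => H.isMorley (isTriIncreasing_of_isMorley_pairs ha)⟩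
  · exact fun H => finiteIncreasingGeneric_of_forall_nat hM hA fun a ha =>
      H.2.2 a fun i j hij => isMorley_pair_iff.2 ⟨ha.1 i, ha.2 i j hij⟩

theorem finiteIncreasingGeneric_iff_isOrderTrivialOver [Infinite M] (hM : IsSaturated L M)
    (hA : #A < #M) (hmax : ∀ a, ∃ b, lt a b) :
    FiniteIncreasingGeneric h hne ↔ IsOrderTrivialOver (rightGlobal h hne) A := by
  constructor
  · refine fun H => ⟨isNonalgebraicGlobal_rightGlobal h hne hmax,
      isInvariant_rightGlobal h hne hM hA hmax, fun a ha => H.isMorley ⟨fun i => ?_, ?_⟩⟩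
    · exact (isMorley_pair_iff.1 (ha i)).1
    · intro i j hij
      -- Transitivity extends `◁` from consecutive terms to all pairs.
      induction j, hij using Nat.le_induction with
      | base => exact (isMorley_pair_iff.1 (ha i)).2
      | succ j _ ih => exact tri_trans hM hA hmax ih (isMorley_pair_iff.1 (ha j)).2
  · exact fun H => finiteIncreasingGeneric_of_forall_nat hM hA fun a ha =>
      H.2.2 a fun i => isMorley_pair_iff.2 ⟨ha.1 i, ha.2 i (i + 1) i.lt_succ_self⟩

end Triviality

end WeakOMin

theorem mainTheorem4 {L : FirstOrder.Language.{u, v}} {M : Type w} [L.Structure M]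
    [Nonempty M] (hM : WeakOMin.IsSaturated L M) {n : ℕ} {A : Set M} (hA : #A < #M)
    (p : WeakOMin.TypeOver L M A n)
    (lt : WeakOMin.locus p → WeakOMin.locus p → Prop)
    (hp : WeakOMin.IsWeaklyOMinimalPair p lt)
    (hna : WeakOMin.IsNonalgebraic p) :
    List.TFAE [
      WeakOMin.IsTrivialOver (WeakOMin.rightGlobal hp (hM A hA n p)) A,
      ∀ a : ℕ → Fin n → M, WeakOMin.IsTriIncreasing hp (hM A hA n p) a →
        WeakOMin.IsMorley (WeakOMin.rightGlobal hp (hM A hA n p)) A a,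
      ∀ (I : Type t) [LinearOrder I] (a : I → Fin n → M),
        WeakOMin.IsTriIncreasing hp (hM A hA n p) a →
          WeakOMin.IsMorley (WeakOMin.rightGlobal hp (hM A hA n p)) A a,
      WeakOMin.IsOrderTrivialOver (WeakOMin.rightGlobal hp (hM A hA n p)) A,
      ∀ a : ℕ → Fin n → M, WeakOMin.IsTriDecreasing hp (hM A hA n p) a →
        WeakOMin.IsMorley (WeakOMin.leftGlobal hp (hM A hA n p)) A a,
      ∀ (I : Type t) [LinearOrder I] (a : I → Fin n → M),
        WeakOMin.IsTriDecreasing hp (hM A hA n p) a →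
          WeakOMin.IsMorley (WeakOMin.leftGlobal hp (hM A hA n p)) A a,
      WeakOMin.IsOrderTrivialOver (WeakOMin.leftGlobal hp (hM A hA n p)) A] := by
  have hne := hM A hA n p
  have hinf : Infinite M := WeakOMin.infinite_of_isNonalgebraic hne hna
  have hmax := hp.exists_lt hM hA hna
  have hmin : ∀ a, ∃ b, lt b a := hp.reverse.exists_lt hM hA hna
  have hrev : WeakOMin.FiniteIncreasingGeneric hp hne ↔
      WeakOMin.FiniteIncreasingGeneric hp.reverse hne :=
    ⟨fun H => H.reverse hM hA hmax hmin,
      fun H => WeakOMin.FiniteIncreasingGeneric.reverse (h := hp.reverse) hM hA hmin hmax H⟩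
  have h1 := WeakOMin.finiteIncreasingGeneric_iff_isTrivialOver (h := hp) (hne := hne) hM hA hmax
  have h2 := WeakOMin.finiteIncreasingGeneric_iff_forall_nat (h := hp) (hne := hne) hM hA
  have h3 := WeakOMin.finiteIncreasingGeneric_iff_forall_linearOrder.{u, v, w, t}
    (h := hp) (hne := hne) hM hA
  have h4 := WeakOMin.finiteIncreasingGeneric_iff_isOrderTrivialOver
    (h := hp) (hne := hne) hM hA hmax
  -- The left globalization is by definition the right globalization of the reversed pair, so the
  -- same equivalences cover the left-hand conditions.
  have h5 := WeakOMin.finiteIncreasingGeneric_iff_forall_nat (h := hp.reverse) (hne := hne) hM hA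
  have h6 := WeakOMin.finiteIncreasingGeneric_iff_forall_linearOrder.{u, v, w, t}
    (h := hp.reverse) (hne := hne) hM hA
  have h7 := WeakOMin.finiteIncreasingGeneric_iff_isOrderTrivialOver
    (h := hp.reverse) (hne := hne) hM hA hmin
  tfae_have 1 ↔ 2 := h1.symm.trans h2
  tfae_have 2 ↔ 3 := h2.symm.trans h3
  tfae_have 3 ↔ 4 := h3.symm.trans h4
  have h5' := h5.trans (forall_congr' fun a => imp_congr_left
    (WeakOMin.isTriIncreasing_reverse_iff (h := hp) hM hA hmax hmin))
  have h6' := h6.trans (forall_congr' fun I => forall_congr' fun _ => forall_congr' fun a =>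
    imp_congr_left (WeakOMin.isTriIncreasing_reverse_iff (h := hp) hM hA hmax hmin))
  tfae_have 4 ↔ 5 := h4.symm.trans (hrev.trans h5')
  tfae_have 5 ↔ 6 := h5'.symm.trans h6'
  tfae_have 6 ↔ 7 := h6'.symm.trans h7
  tfae_finish
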